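/- Let $n\ge 0$ and $c\ge 1$ be integers, let $J$ be a finite set, and for $j\in J$ let $M_j=x_0^{c}x_1^{a_{1,j}}\cdots x_n^{a_{n,j}}\in\mathbb C[x_0,\dots,x_n]$ with $a_{i,j}\ge c$ for all $i,j$. For each $1\le i\le n$ sort the exponents $(a_{i,j})_{j\in J}$ increasingly, with repetitions, and let $\mathcal D_i$ be the multiset of differences of successive exponents. Assume that the collection $\mathcal M=\{M_j\}_{j\in J}$ is free, meaning that for every $i$ the multiset $\mathcal D_i$ contains $1$ at most once, and every element of $\mathcal D_i$ other than $0$ and $1$ is greater than $c$. (In particular this holds if no $\mathcal D_i$ contains a nonzero integer $\le c$.) For a finite collection $\mathcal F=\{F_j\}_{j\in J}$ of forms, of possibly different degrees $d_j=\deg F_j$, the simultaneous Waring rank $\operatorname{rk}_{\mathbb C}\mathcal F$ is the least integer $r\ge 0$ for which there are linear forms $L_1,\dots,L_r$ such that every $F_j$ is a $\mathbb C$-linear combination of $L_1^{d_j},\dots,L_r^{d_j}$; for a single form $F$, $\operatorname{rk}_{\mathbb C}F$ is the rank of the collection $\{F\}$. Then these ranks are well defined (such decompositions exist) for $\mathcal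 M$ and for the greatest common divisor of every nonempty subfamily of $\mathcal M$, and $$ \operatorname{rk}_{\mathbb C}\mathcal M=\sum_{\emptyset\ne S\subseteq J}(-1)^{|S|+1}\operatorname{rk}_{\mathbb C}\gcd(M_j : j\in S). $$ -/

import Mathlib

open MvPolynomial

noncomputable section

/-- The forms `F j` are simultaneously decomposed by `r` linear forms `L 1, …, L r`: each `F j` is a
complex linear combination of the powers `L k ^ deg (F j)`.  The degrees of the `F j` may differ. -/
def HasSimultaneousDecomposition {σ J : Type*} (F : J → MvPolynomial σ ℂ) (r : ℕ) : Prop :=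
  ∃ L : Fin r → MvPolynomial σ ℂ, (∀ k, (L k).IsHomogeneous 1) ∧
    ∀ j, ∃ coeffs : Fin r → ℂ, F j = ∑ k, C (coeffs k) * L k ^ (F j).totalDegree

/-- The simultaneous Waring rank over `ℂ` of a collection of forms: the least number of linear forms
in a simultaneous decomposition. -/
def simultaneousWaringRank {σ J : Type*} (F : J → MvPolynomial σ ℂ) : ℕ :=
  sInf {r | HasSimultaneousDecomposition F r}

/-- The Waring rank over `ℂ` of a single form. -/
def waringRank {σ : Type*} (F : MvPolynomial σ ℂ) : ℕ :=
  simultaneousWaringRank (fun _ : Unit => F)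

/-- The monomial `x₀ ^ c * x₁ ^ a₁ * ⋯ * xₙ ^ aₙ` in `ℂ[x₀, …, xₙ]`. -/
def specialMonomial {n : ℕ} (c : ℕ) (a : Fin n → ℕ) : MvPolynomial (Fin (n + 1)) ℂ :=
  X 0 ^ c * ∏ i : Fin n, X i.succ ^ a i

/-- The greatest common divisor of the monomials `x₀ ^ c * x₁ ^ (a j 1) * ⋯ * xₙ ^ (a j n)`, `j ∈ S`:
the exponent of each variable is the least of its exponents
(`dvd_gcdSpecialMonomial_iff` shows that this is the gcd in the polynomial ring). -/
def gcdSpecialMonomial {n : ℕ} {J : Type*} (c : ℕ) (a : J → Fin n → ℕ) (S : Finset J)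
    (hS : S.Nonempty) : MvPolynomial (Fin (n + 1)) ℂ :=
  specialMonomial c (fun i => S.inf' hS (fun j => a j i))

/-- The multiset of differences of successive elements in the list of the numbers `e j`, `j : J`,
sorted in increasing order and with repetitions kept. -/
def successiveGaps {J : Type*} [Fintype J] (e : J → ℕ) : Multiset ℕ :=
  let l : List ℕ := (Finset.univ.val.map e).sort (· ≤ ·)
  ((List.zipWith (fun x y => y - x) l l.tail : List ℕ) : Multiset ℕ)

/-- For each of the variables `x₁, …, xₙ` the multiset of gaps contains `1` at most once. -/
def IsOneOneFree {n : ℕ} {J : Type*} [Fintype J] (a : J → Fin n → ℕ) : Prop :=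
  ∀ i, (successiveGaps (fun j => a j i)).count 1 ≤ 1

/-- Free collections: for each of the variables `x₁, …, xₙ`, the gap `1` occurs at most once, and
every gap other than `0` and `1` exceeds `c`.  The gap `1`, which is governed by the first clause, is
exempted from the second, so that this condition is implied by the one where it is not exempted
(`isFree_of_forall_gap`). -/
def IsFree {n : ℕ} {J : Type*} [Fintype J] (c : ℕ) (a : J → Fin n → ℕ) : Prop :=
  IsOneOneFree a ∧ ∀ i, ∀ d ∈ successiveGaps (fun j => a j i), d ≠ 0 → d ≠ 1 → c < d

/-- A collection with at most one gap `1` and no nonzero gap `≤ c` at all is free. -/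
theorem isFree_of_forall_gap {n : ℕ} {J : Type*} [Fintype J] {c : ℕ} {a : J → Fin n → ℕ}
    (h₁ : IsOneOneFree a)
    (h₂ : ∀ i, ∀ d ∈ successiveGaps (fun j => a j i), d ≠ 0 → ¬ d ≤ c) : IsFree c a :=
  ⟨h₁, fun i d hd h0 _ => not_le.mp (h₂ i d hd h0)⟩

theorem specialMonomial_eq_monomial {n : ℕ} (c : ℕ) (a : Fin n → ℕ) :
    specialMonomial c a = monomial (Finsupp.equivFunOnFinite.symm (Fin.cons c a)) 1 := by
  rw [monomial_eq, Finsupp.prod_fintype _ _ (by simp), Fin.prod_univ_succ]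
  simp [specialMonomial]

/-- `gcdSpecialMonomial` is the greatest common divisor. -/
theorem dvd_gcdSpecialMonomial_iff {n : ℕ} {J : Type*} (c : ℕ) (a : J → Fin n → ℕ) (S : Finset J)
    (hS : S.Nonempty) (p : MvPolynomial (Fin (n + 1)) ℂ) :
    p ∣ gcdSpecialMonomial c a S hS ↔ ∀ j ∈ S, p ∣ specialMonomial c (a j) := by
  constructor
  · intro h j hj
    refine h.trans (mul_dvd_mul_left _ (Finset.prod_dvd_prod_of_dvd _ _ fun i _ => ?_))
    exact pow_dvd_pow _ (Finset.inf'_le _ hj)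
  · intro h
    obtain ⟨j₀, hj₀⟩ := id hS
    have h0 := h j₀ hj₀
    rw [specialMonomial_eq_monomial, dvd_monomial_iff_exists one_ne_zero] at h0
    obtain ⟨m, b, hm, hb, rfl⟩ := h0
    rw [gcdSpecialMonomial, specialMonomial_eq_monomial, monomial_dvd_monomial]
    refine ⟨Or.inr fun k => ?_, hb⟩
    have key : ∀ j ∈ S, ∀ k, m k ≤ (Fin.cons c (a j) : Fin (n + 1) → ℕ) k := by
      intro j hj k
      have h1 := h j hj
      rw [specialMonomial_eq_monomial, monomial_dvd_monomial] at h1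
      rcases h1.1 with h2 | h2
      · exact absurd h2 one_ne_zero
      · exact h2 k
    refine Fin.cases ?_ (fun i => ?_) k
    · simpa using key j₀ hj₀ 0
    · simp only [Finsupp.equivFunOnFinite_symm_apply_apply, Fin.cons_succ]
      exact Finset.le_inf' _ _ fun j hj => by simpa using key j hj i.succ

end

/-!
Let `D` be the set of exponents `u = (u₁, …, uₙ)` with `u ≤ a j` for some `j`; the rank is `#D`.

*Lower bound.* Put the linear forms in a decomposition at the points `(y_i / y_0)_i` of affine
space, those with `y_0 = 0` being dropped.  If there are fewer than `#D` of them, some `p ≠ 0` in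
the span of the monomials with exponents in `D` vanishes at all points.  Take a monomial `x ^ u` of
top degree in `p`, with `u ≤ a j`.  The form `x₀ ^ c * x ^ (a j - u) * pʰ`, with `pʰ` the
homogenization of `p`, vanishes on all linear forms because `c ≥ 1`, but contains `M_j`,
contradicting apolarity.

*Upper bound.* A decomposition of `M_j` by the points of a grid `∏ i, Z i` with `#Z i = a j i + 1`
amounts to one-variable weights on `Z i` whose moments of orders `≤ a j i + c` are those of a delta
function at `a j i`.  Such weights exist as soon as the power sums of orders `1, …, c` of `Z i`
vanish.  Freeness yields one sequence of nodes per variable all of whose initial segments of the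
required lengths have this property: a gap `d > c` is filled with the `d`-th roots of a generic
number, the single gap `1` with the node `0`.  The union of the grids then has `#D` points.

Inclusion-exclusion for the boxes `{u | u ≤ a j}` concludes, since the intersection of boxes
corresponds to the gcd.
-/

section Apolarity

variable {K σ κ : Type*} [Field K] [Fintype σ]

/-- The linear form with coefficient vector `l`. -/
noncomputable def linearForm (l : σ → K) : MvPolynomial σ K :=
  ∑ i, l i • X i

theorem isHomogeneous_linearForm (l : σ → K) : (linearForm l).IsHomogeneous 1 :=
  IsHomogeneous.sum _ _ _ fun i _ => by
    simpa only [smul_eq_C_mul] using isHomogeneous_C_mul_X (l i) i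

theorem exists_eq_linearForm {L : MvPolynomial σ K} (hL : L.IsHomogeneous 1) :
    ∃ l, L = linearForm l := by
  rw [← mem_homogeneousSubmodule, homogeneousSubmodule_one_eq_span_X,
    Submodule.mem_span_range_iff_exists_fun] at hL
  exact hL.imp fun _ h => h.symm

theorem coeff_linearForm_pow_degree (l : σ → K) (m : σ →₀ ℕ) :
    coeff m (linearForm l ^ m.degree) = m.multinomial * eval l (monomial m 1) := by
  rw [linearForm, coeff_linearCombination_X_pow_of_fintype, if_pos (by rfl), eval_monomial,
    one_mul]

theorem monomial_eq_sum_linearForm_pow_iff [CharZero K] (m : σ →₀ ℕ) (s : Finset κ) (w : κ → K)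
    (l : κ → σ → K) :
    monomial m 1 = ∑ k ∈ s, C (w k) * linearForm (l k) ^ m.degree ↔
      ∀ m' : σ →₀ ℕ, m'.degree = m.degree →
        m.multinomial * ∑ k ∈ s, w k * eval (l k) (monomial m' 1) =
          coeff m (monomial m' (1 : K)) := by
  classical
  have hhom : (∑ k ∈ s, C (w k) * linearForm (l k) ^ m.degree).IsHomogeneous m.degree :=
    IsHomogeneous.sum _ _ _ fun k _ => by
      simpa only [one_mul] using ((isHomogeneous_linearForm (l k)).pow m.degree).C_mul (w k)
  have hcoeff : ∀ m' : σ →₀ ℕ, m'.degree = m.degree →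
      coeff m' (∑ k ∈ s, C (w k) * linearForm (l k) ^ m.degree) =
        m'.multinomial * ∑ k ∈ s, w k * eval (l k) (monomial m' 1) := fun m' hm' => by
    simp only [coeff_sum, coeff_C_mul, ← hm', coeff_linearForm_pow_degree, Finset.mul_sum,
      mul_left_comm]
  have hmult : ∀ m' : σ →₀ ℕ, (m'.multinomial : K) ≠ 0 := fun m' =>
    Nat.cast_ne_zero.mpr (Nat.multinomial_pos _ _).ne'
  rw [MvPolynomial.ext_iff]
  refine forall_congr' fun m' => ?_
  by_cases hm' : m'.degree = m.degree
  · rw [hcoeff m' hm', coeff_monomial, coeff_monomial]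
    obtain rfl | hne := eq_or_ne m m'
    · simp [eq_comm]
    · simp [hne, hne.symm, hmult, hm']
  · rw [(isHomogeneous_monomial 1 rfl).coeff_eq_zero hm', hhom.coeff_eq_zero hm']
    simp [hm']

theorem coeff_eq_zero_of_forall_eval_eq_zero [CharZero K] {m : σ →₀ ℕ} {s : Finset κ} {w : κ → K}
    {l : κ → σ → K} (h : monomial m 1 = ∑ k ∈ s, C (w k) * linearForm (l k) ^ m.degree)
    {H : MvPolynomial σ K} (hH : H.IsHomogeneous m.degree) (hvan : ∀ k ∈ s, eval (l k) H = 0) :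
    coeff m H = 0 := by
  have hmono := (monomial_eq_sum_linearForm_pow_iff m s w l).mp h
  have hquad : m.multinomial * ∑ k ∈ s, w k * eval (l k) H = coeff m H := by
    rw [H.as_sum]
    simp only [map_sum, coeff_sum, Finset.mul_sum]
    rw [Finset.sum_comm]
    refine Finset.sum_congr rfl fun m' hm' => ?_
    rw [← mul_one (coeff m' H), ← smul_eq_mul (coeff m' H), ← smul_monomial, coeff_smul,
      ← hmono m' (hH.degree_eq_sum_deg_support hm').symm, Finset.mul_sum, Finset.smul_sum]
    refine Finset.sum_congr rfl fun k _ => ?_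
    rw [smul_eval, smul_eq_mul]
    ring
  rw [← hquad, Finset.sum_eq_zero fun k hk => by rw [hvan k hk, mul_zero], mul_zero]

end Apolarity

section Homogenization

variable {n : ℕ}

theorem degree_finsuppCons (s : ℕ) (u : Fin n →₀ ℕ) : (u.cons s).degree = s + u.degree := by
  simp only [Finsupp.degree_eq_sum, Fin.sum_univ_succ, Finsupp.cons_zero, Finsupp.cons_succ]

/-- The homogenization to degree `d` of a polynomial of degree at most `d` with respect to a new
variable, which gets the index `0`. -/
noncomputable def homogenization {R : Type*} [CommSemiring R] (d : ℕ) (p : MvPolynomial (Fin n) R) :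
    MvPolynomial (Fin (n + 1)) R :=
  ∑ u ∈ p.support, monomial (u.cons (d - u.degree)) (coeff u p)

theorem isHomogeneous_homogenization {R : Type*} [CommSemiring R] {d : ℕ}
    {p : MvPolynomial (Fin n) R} (hp : p.totalDegree ≤ d) : (homogenization d p).IsHomogeneous d :=
  IsHomogeneous.sum _ _ _ fun u hu => isHomogeneous_monomial _ <| by
    rw [degree_finsuppCons]
    exact Nat.sub_add_cancel ((le_totalDegree hu).trans hp)

theorem coeff_cons_zero_homogenization {R : Type*} [CommSemiring R] {d : ℕ}
    (p : MvPolynomial (Fin n) R) {u : Fin n →₀ ℕ} (hu : d ≤ u.degree) :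
    coeff (u.cons 0) (homogenization d p) = coeff u p := by
  classical
  simp only [homogenization, coeff_sum, coeff_monomial, Finsupp.cons_injective2.eq_iff]
  rw [Finset.sum_eq_single u]
  · simp [hu]
  · intro v _ hv
    simp [hv]
  · simp +contextual

theorem eval_homogenization {K : Type*} [Field K] {d : ℕ} {p : MvPolynomial (Fin n) K}
    (hp : p.totalDegree ≤ d) {x : Fin (n + 1) → K} (hx : x 0 ≠ 0) :
    eval x (homogenization d p) = x 0 ^ d * eval (fun i => x i.succ / x 0) p := by
  rw [homogenization, map_sum, eval_eq' _ p, Finset.mul_sum]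
  refine Finset.sum_congr rfl fun u hu => ?_
  have hdeg : ∑ i, u i ≤ d := u.degree_eq_sum ▸ (le_totalDegree hu).trans hp
  simp only [eval_monomial, Finsupp.prod_fintype _ _ fun _ => pow_zero _, Fin.prod_univ_succ,
    Finsupp.cons_zero, Finsupp.cons_succ, div_pow, Finset.prod_div_distrib,
    Finset.prod_pow_eq_pow_sum, Finsupp.degree_eq_sum, pow_sub₀ _ hx hdeg]
  ring

end Homogenization

section LowerBound

variable {n : ℕ}

theorem exists_eval_ne_zero_of_monomial_cons_eq_sum {K κ : Type*} [Field K] [CharZero K] {c : ℕ}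
    (hc : c ≠ 0) {b : Fin n →₀ ℕ} {s : Finset κ} {w : κ → K} {l : κ → Fin (n + 1) → K}
    (h : monomial (b.cons c) 1 = ∑ k ∈ s, C (w k) * linearForm (l k) ^ (b.cons c).degree)
    {p : MvPolynomial (Fin n) K} {u : Fin n →₀ ℕ} (hu : u ∈ p.support)
    (hdeg : u.degree = p.totalDegree) (hub : u ≤ b) :
    ∃ k ∈ s, eval (fun i => l k i.succ / l k 0) p ≠ 0 := by
  by_contra! hvan
  set d := p.totalDegree
  let q : MvPolynomial (Fin (n + 1)) K := monomial ((b - u).cons c) 1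
  have hexp : b.cons c = (b - u).cons c + u.cons 0 := by
    ext i
    refine Fin.cases ?_ (fun i => ?_) i
    · simp
    · simp [Nat.sub_add_cancel (hub i)]
  have hhom : (q * homogenization d p).IsHomogeneous (b.cons c).degree := by
    rw [hexp, map_add, degree_finsuppCons 0, zero_add, hdeg]
    exact (isHomogeneous_monomial 1 rfl).mul (isHomogeneous_homogenization le_rfl)
  have hzero : ∀ k ∈ s, eval (l k) (q * homogenization d p) = 0 := by
    intro k hk
    rw [map_mul]
    rcases eq_or_ne (l k 0) 0 with h0 | h0
    · simp [q, eval_monomial, Finsupp.prod_fintype, Fin.prod_univ_succ, h0, hc]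
    · rw [eval_homogenization le_rfl h0, hvan k hk, mul_zero, mul_zero]
  have hcoeff := coeff_eq_zero_of_forall_eval_eq_zero h hhom hzero
  rw [hexp, coeff_monomial_mul, one_mul, coeff_cons_zero_homogenization p hdeg.ge] at hcoeff
  exact mem_support_iff.mp hu hcoeff

theorem card_le_of_forall_exists_eval_ne_zero {σ κ K : Type*} [Field K] [Fintype κ]
    {D : Finset (σ →₀ ℕ)} (x : κ → σ → K)
    (h : ∀ p : MvPolynomial σ K, p ≠ 0 → p.support ⊆ D → ∃ k, eval (x k) p ≠ 0) :
    D.card ≤ Fintype.card κ := by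
  let evalAt : restrictSupport K (D : Set (σ →₀ ℕ)) →ₗ[K] κ → K :=
    LinearMap.pi fun k => (aeval (x k)).toLinearMap ∘ₗ Submodule.subtype _
  have hinj : Function.Injective evalAt := by
    refine (injective_iff_map_eq_zero evalAt).mpr fun p hp => ?_
    by_contra hne
    obtain ⟨k, hk⟩ := h p (by simpa using hne) (Finset.coe_subset.mp p.2)
    exact hk (congrFun hp k)
  calc D.card = Module.finrank K (restrictSupport K (D : Set (σ →₀ ℕ))) := by
        rw [Module.finrank_eq_card_basis (basisRestrictSupport K _)]
        simp
    _ ≤ Module.finrank K (κ → K) := LinearMap.finrank_le_finrank_of_injective hinj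
    _ = Fintype.card κ := Module.finrank_fintype_fun_eq_card K

theorem specialMonomial_eq_monomial_finsuppCons (c : ℕ) (a : Fin n → ℕ) :
    specialMonomial c a = monomial ((Finsupp.equivFunOnFinite.symm a).cons c) 1 := by
  rw [specialMonomial_eq_monomial]
  rfl

theorem totalDegree_specialMonomial (c : ℕ) (a : Fin n → ℕ) :
    (specialMonomial c a).totalDegree = ((Finsupp.equivFunOnFinite.symm a).cons c).degree := by
  rw [specialMonomial_eq_monomial_finsuppCons, totalDegree_monomial _ one_ne_zero]
  rfl

theorem card_biUnion_Iic_le_of_hasSimultaneousDecomposition {J : Type*} [Fintype J] {c r : ℕ}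
    (hc : c ≠ 0) {a : J → Fin n → ℕ}
    (h : HasSimultaneousDecomposition (fun j => specialMonomial c (a j)) r) :
    (Finset.univ.biUnion fun j => Finset.Iic (a j)).card ≤ r := by
  obtain ⟨L, hL, hdec⟩ := h
  choose l hl using fun k => exists_eq_linearForm (hL k)
  choose w hw using hdec
  rw [← Finset.card_map Finsupp.equivFunOnFinite.symm.toEmbedding, ← Fintype.card_fin r]
  refine card_le_of_forall_exists_eval_ne_zero (fun k i => l k i.succ / l k 0) fun p hp hpD => ?_
  obtain ⟨u, hu, hdeg⟩ := Finset.exists_mem_eq_sup p.support (support_nonempty.mpr hp)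
    Finsupp.degree
  obtain ⟨j, huj⟩ : ∃ j, Finsupp.equivFunOnFinite u ≤ a j := by simpa using hpD hu
  have hj := hw j
  simp only [totalDegree_specialMonomial, hl] at hj
  rw [specialMonomial_eq_monomial_finsuppCons] at hj
  obtain ⟨k, -, hk⟩ := exists_eval_ne_zero_of_monomial_cons_eq_sum hc hj hu hdeg.symm huj
  exact ⟨k, hk⟩

end LowerBound

section BalancedNodes

variable {K ι : Type*} [Field K]

/-- The nodes `z k`, `k ∈ t`, are distinct and their power sums of orders `1, …, c` vanish.  By
Newton's identities, the `c` coefficients below the leading one of the polynomial with these roots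
vanish, or all of them if there are fewer than `c`. -/
structure IsBalanced (c : ℕ) (t : Finset ι) (z : ι → K) : Prop where
  injOn : Set.InjOn z t
  sum_pow_eq_zero : ∀ s, 0 < s → s ≤ c → ∑ k ∈ t, z k ^ s = 0

namespace IsBalanced

variable {c : ℕ} {t u : Finset ι} {z z' : ι → K}

theorem congr (hz : IsBalanced c t z) (h : Set.EqOn z' z t) : IsBalanced c t z' where
  injOn := hz.injOn.congr h.symm
  sum_pow_eq_zero s h0 hs := by
    rw [← hz.sum_pow_eq_zero s h0 hs]
    exact Finset.sum_congr rfl fun k hk => by rw [h hk]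

theorem piecewise [DecidableEq ι] (hz : IsBalanced c t z) (hz' : IsBalanced c u z')
    (htu : Disjoint t u) (hne : ∀ k ∈ t, ∀ l ∈ u, z k ≠ z' l) :
    IsBalanced c (t ∪ u) (t.piecewise z z') := by
  have hleft : ∀ k ∈ t, t.piecewise z z' k = z k := fun k => t.piecewise_eq_of_mem z z'
  have hright : ∀ k ∈ u, t.piecewise z z' k = z' k := fun k hk =>
    t.piecewise_eq_of_notMem z z' (Finset.disjoint_right.mp htu hk)
  constructor
  · rw [Finset.coe_union, Set.injOn_union (Finset.disjoint_coe.mpr htu)]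
    refine ⟨(hz.congr hleft).injOn, (hz'.congr hright).injOn, fun k hk l hl => ?_⟩
    rw [hleft k hk, hright l hl]
    exact hne k hk l hl
  · intro s h0 hs
    rw [Finset.sum_union htu, (hz.congr hleft).sum_pow_eq_zero s h0 hs,
      (hz'.congr hright).sum_pow_eq_zero s h0 hs, add_zero]

theorem esymm_eq_zero [CharZero K] (hz : IsBalanced c t z) {s : ℕ} (h0 : 0 < s) (hs : s ≤ c) :
    (t.val.map z).esymm s = 0 := by
  have hnewton := congrArg (aeval fun k : t => z k) (mul_esymm_eq_sum t K s)
  have hval : (Finset.univ : Finset t).val.map (fun k : t => z k) = t.val.map z := by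
    rw [← Finset.attach_eq_univ, Finset.attach_val]
    exact Multiset.attach_map_val' t.val z
  rw [map_mul, map_mul, map_sum, Finset.sum_eq_zero, mul_zero, map_natCast,
    aeval_esymm_eq_multiset_esymm t K, hval] at hnewton
  · exact (mul_eq_zero.mp hnewton).resolve_left (Nat.cast_ne_zero.mpr h0.ne')
  · intro p hp
    obtain ⟨hadd, hlt⟩ : p.1 + p.2 = s ∧ p.1 < s := by simpa using hp
    have hpsum : aeval (fun k : t => z k) (psum t K p.2) = 0 := by
      simp only [psum, map_sum, map_pow, aeval_X]
      rw [Finset.sum_coe_sort t fun k => z k ^ p.2]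
      exact hz.sum_pow_eq_zero p.2 (by lia) (by lia)
    rw [map_mul, hpsum, mul_zero]

theorem coeff_X_pow_sub_prod_eq_zero [CharZero K] (hz : IsBalanced c t z) {i : ℕ}
    (hi : t.card ≤ i + c) :
    (Polynomial.X ^ t.card - ∏ k ∈ t, (Polynomial.X - Polynomial.C (z k))).coeff i = 0 := by
  have hprod : ∏ k ∈ t, (Polynomial.X - Polynomial.C (z k)) =
      ((t.val.map z).map fun x => Polynomial.X - Polynomial.C x).prod := by
    rw [Multiset.map_map]
    rfl
  have hcard : (t.val.map z).card = t.card := Multiset.card_map z _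
  rw [Polynomial.coeff_sub, Polynomial.coeff_X_pow]
  obtain hlt | rfl | hgt := lt_trichotomy i t.card
  · rw [if_neg hlt.ne, hprod, Multiset.prod_X_sub_C_coeff _ (hcard ▸ hlt.le), hcard,
      hz.esymm_eq_zero (by lia) (by lia), mul_zero, sub_zero]
  · rw [if_pos rfl, hprod, Multiset.prod_X_sub_C_coeff _ hcard.ge, hcard]
    simp [Multiset.esymm]
  · rw [if_neg hgt.ne', Polynomial.coeff_eq_zero_of_natDegree_lt (by simpa using hgt), sub_zero]

theorem exists_weights [CharZero K] (hz : IsBalanced c t z) :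
    ∃ w : ι → K, ∀ s < t.card + c, ∑ k ∈ t, w k * z k ^ s = if s + 1 = t.card then 1 else 0 := by
  classical
  let w k := (Lagrange.basis t z k).coeff (t.card - 1)
  have hquad : ∀ P : Polynomial K, P.degree < t.card →
      ∑ k ∈ t, w k * P.eval (z k) = P.coeff (t.card - 1) := by
    intro P hP
    conv_rhs => rw [Lagrange.eq_interpolate hz.injOn hP, Lagrange.interpolate_apply,
      Polynomial.finsetSum_coeff]
    exact Finset.sum_congr rfl fun k _ => by rw [Polynomial.coeff_C_mul, mul_comm]
  refine ⟨w, fun s hs => ?_⟩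
  obtain hlt | hle := lt_or_ge s t.card
  · have hX := hquad (Polynomial.X ^ s) (by simpa using hlt)
    simp only [Polynomial.eval_pow, Polynomial.eval_X, Polynomial.coeff_X_pow] at hX
    rw [hX]
    exact if_congr (by lia) rfl rfl
  -- Reduce `X ^ s` modulo the polynomial with roots `z k`.
  let N := ∏ k ∈ t, (Polynomial.X - Polynomial.C (z k))
  let P := (Polynomial.X ^ t.card - N) * Polynomial.X ^ (s - t.card)
  have hP : ∀ i, t.card - 1 ≤ i → P.coeff i = 0 := by
    intro i hi
    rw [Polynomial.coeff_mul_X_pow']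
    split_ifs
    · exact hz.coeff_X_pow_sub_prod_eq_zero (by lia)
    · rfl
  have heval : ∀ k ∈ t, P.eval (z k) = z k ^ s := by
    intro k hk
    have hN : N.eval (z k) = 0 := by
      rw [Polynomial.eval_prod]
      exact Finset.prod_eq_zero hk (by simp)
    simp [P, hN, ← pow_add, hle]
  rw [if_neg (by lia), ← hP (t.card - 1) le_rfl, ← hquad P]
  · exact Finset.sum_congr rfl fun k hk => by rw [heval k hk]
  · exact (Polynomial.degree_lt_iff_coeff_zero _ _).mpr fun i hi => hP i (by lia)

end IsBalanced

end BalancedNodes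

section BalancedExtension

variable {K : Type*} [Field K] {c : ℕ}

theorem isBalanced_singleton_zero {ι : Type*} (k : ι) :
    IsBalanced c {k} (fun _ => (0 : K)) where
  injOn := by simp
  sum_pow_eq_zero s h0 _ := by simp [h0.ne']

theorem isBalanced_Ico_mul_pow {m d : ℕ} (hcd : c < d) {τ ω : K} (hτ : τ ≠ 0)
    (hω : IsPrimitiveRoot ω d) : IsBalanced c (Finset.Ico m (m + d)) fun k => τ * ω ^ k where
  injOn k hk l hl hkl := by
    have hmod : k ≡ l [MOD d] := by
      rw [hω.eq_orderOf]
      exact (hω.isOfFinOrder (by lia)).pow_eq_pow_iff_modEq.mp (mul_left_cancel₀ hτ hkl)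
    rw [Finset.coe_Ico, Set.mem_Ico] at hk hl
    exact hmod.eq_of_abs_lt (by rw [abs_lt]; lia)
  sum_pow_eq_zero s h0 hs := by
    have hne : ω ^ s ≠ 1 := hω.pow_ne_one_of_pos_of_lt h0.ne' (by lia)
    simp only [mul_pow, ← pow_mul, mul_comm _ s]
    simp only [pow_mul, ← Finset.mul_sum]
    rw [geom_sum_Ico hne (Nat.le_add_right m d), pow_add, ← pow_mul ω s d, mul_comm s, pow_mul ω d,
      hω.pow_eq_one, one_pow, mul_one, sub_self, zero_div, mul_zero]

variable [CharZero K] [IsAlgClosed K]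

theorem exists_isBalanced_Ico {m n : ℕ} (hc : c < n - m) (A : Finset K) :
    ∃ z : ℕ → K, IsBalanced c (Finset.Ico m n) z ∧ ∀ k, z k ∉ A := by
  classical
  obtain ⟨d, rfl⟩ := Nat.exists_eq_add_of_le (show m ≤ n by lia)
  have hd : d ≠ 0 := by lia
  obtain ⟨t, ht⟩ := Infinite.exists_notMem_finset (insert 0 (A.image (· ^ d)))
  simp only [Finset.mem_insert, Finset.mem_image, not_or, not_exists, not_and] at ht
  obtain ⟨τ, rfl⟩ := IsAlgClosed.exists_pow_nat_eq t (Nat.pos_of_ne_zero hd)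
  have : NeZero d := ⟨hd⟩
  obtain ⟨ω, hω⟩ := HasEnoughRootsOfUnity.exists_primitiveRoot K d
  refine ⟨fun k => τ * ω ^ k, isBalanced_Ico_mul_pow (by lia) (ne_zero_pow hd ht.1) hω, ?_⟩
  intro k hk
  refine ht.2 _ hk ?_
  rw [mul_pow, ← pow_mul, mul_comm k, pow_mul, hω.pow_eq_one, one_pow, mul_one]

theorem exists_isBalanced_Ioc {x y : ℕ} {A : Finset K} (hgap : y - x ≠ 0 → y - x ≠ 1 → c < y - x)
    (hzero : y - x = 1 → 0 ∉ A) :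
    ∃ z : ℕ → K, IsBalanced c (Finset.Ioc x y) z ∧ ∀ k, z k ∉ A ∧ (y - x ≠ 1 → z k ≠ 0) := by
  classical
  have hIoc : Finset.Ioc x y = Finset.Ico (x + 1) (y + 1) := by ext; simp
  rcases eq_or_ne (y - x) 1 with h1 | h1
  · obtain rfl : y = x + 1 := by lia
    rw [hIoc, Nat.Ico_succ_singleton]
    exact ⟨fun _ => 0, isBalanced_singleton_zero _, fun _ => ⟨hzero h1, absurd h1⟩⟩
  rcases eq_or_ne (y - x) 0 with h0 | h0
  · obtain ⟨t, ht⟩ := Infinite.exists_notMem_finset (insert 0 A)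
    rw [Finset.mem_insert, not_or] at ht
    rw [Finset.Ioc_eq_empty (by lia)]
    exact ⟨fun _ => t, ⟨by simp, by simp⟩, fun _ => ⟨ht.2, fun _ => ht.1⟩⟩
  · obtain ⟨z, hz, hzA⟩ := exists_isBalanced_Ico (m := x + 1) (n := y + 1)
      (by simpa using hgap h0 h1) (insert 0 A)
    simp only [Finset.mem_insert, not_or] at hzA
    exact ⟨z, hIoc ▸ hz, fun k => ⟨(hzA k).2, fun _ => (hzA k).1⟩⟩

theorem IsBalanced.exists_extension {x y : ℕ} {z : ℕ → K} (hz : IsBalanced c (Finset.Iic x) z)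
    (hxy : x ≤ y) (hgap : y - x ≠ 0 → y - x ≠ 1 → c < y - x)
    (hzero : y - x = 1 → ∀ k ≤ x, z k ≠ 0) :
    ∃ z', Set.EqOn z' z (Finset.Iic x) ∧ IsBalanced c (Finset.Iic y) z' ∧
      (y - x ≠ 1 → (∀ k ≤ x, z k ≠ 0) → ∀ k ≤ y, z' k ≠ 0) := by
  classical
  obtain ⟨v, hv, hvA⟩ := exists_isBalanced_Ioc (A := (Finset.Iic x).image z) hgap
    (by simpa using hzero)
  simp only [Finset.mem_image, Finset.mem_Iic, not_exists, not_and] at hvA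
  have hunion : Finset.Iic y = Finset.Iic x ∪ Finset.Ioc x y := by
    ext
    simp only [Finset.mem_union, Finset.mem_Iic, Finset.mem_Ioc]
    lia
  have hdisj : Disjoint (Finset.Iic x) (Finset.Ioc x y) :=
    Finset.disjoint_left.mpr fun k hk hk' =>
      (Finset.mem_Ioc.mp hk').1.not_ge (Finset.mem_Iic.mp hk)
  refine ⟨(Finset.Iic x).piecewise z v, fun k hk => Finset.piecewise_eq_of_mem _ _ _ hk, ?_, ?_⟩
  · rw [hunion]
    exact hz.piecewise hv hdisj fun k hk l _ => (hvA l).1 k (Finset.mem_Iic.mp hk)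
  · intro h1 h0 k _
    rw [Finset.piecewise]
    split_ifs with hk
    · exact h0 k (Finset.mem_Iic.mp hk)
    · exact (hvA k).2 h1

theorem exists_isBalanced_of_pairwise_le (l : List ℕ) : ∀ (x : ℕ) (z : ℕ → K),
    (x :: l).Pairwise (· ≤ ·) → IsBalanced c (Finset.Iic x) z →
    (List.zipWith (fun x y => y - x) (x :: l) l).count 1 ≤ 1 →
    ((List.zipWith (fun x y => y - x) (x :: l) l).count 1 ≠ 0 → ∀ k ≤ x, z k ≠ 0) →
    (∀ d ∈ List.zipWith (fun x y => y - x) (x :: l) l, d ≠ 0 → d ≠ 1 → c < d) →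
    ∃ z', Set.EqOn z' z (Finset.Iic x) ∧ ∀ y ∈ x :: l, IsBalanced c (Finset.Iic y) z' := by
  induction l with
  | nil => exact fun x z _ hz _ _ _ => ⟨z, Set.eqOn_refl _ _, by simpa using hz⟩
  | cons y l ih =>
    intro x z hsort hz hone hzero hlarge
    rw [List.zipWith_cons_cons] at hone hzero hlarge
    obtain ⟨hx, hsort⟩ := List.pairwise_cons.mp hsort
    have hxy : x ≤ y := hx y List.mem_cons_self
    obtain ⟨z₁, heq₁, hz₁, hzero₁⟩ := hz.exists_extension hxy (hlarge _ List.mem_cons_self)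
      fun h => hzero (by simp [h])
    have hone₁ : y - x = 1 → (List.zipWith (fun x y => y - x) (y :: l) l).count 1 = 0 := by
      intro h
      rw [h, List.count_cons_self] at hone
      lia
    obtain ⟨z', heq, hz'⟩ := ih y z₁ hsort hz₁ (List.count_le_count_cons.trans hone)
      (fun h => hzero₁ (mt hone₁ h) (hzero (Nat.ne_of_gt
        ((Nat.pos_of_ne_zero h).trans_le List.count_le_count_cons))))
      fun d hd => hlarge d (List.mem_cons_of_mem _ hd)
    have heqx : Set.EqOn z' z (Finset.Iic x) :=
      (heq.mono (by exact_mod_cast Finset.Iic_subset_Iic.mpr hxy)).trans heq₁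
    exact ⟨z', heqx, List.forall_mem_cons.mpr ⟨hz.congr heqx, hz'⟩⟩

theorem exists_forall_isBalanced_Iic {J : Type*} [Fintype J] {e : J → ℕ} (hce : ∀ j, c ≤ e j)
    (hone : (successiveGaps e).count 1 ≤ 1)
    (hlarge : ∀ d ∈ successiveGaps e, d ≠ 0 → d ≠ 1 → c < d) :
    ∃ z : ℕ → K, ∀ j, IsBalanced c (Finset.Iic (e j)) z := by
  unfold successiveGaps at hone hlarge
  have hmem : ∀ x, x ∈ (Finset.univ.val.map e).sort (· ≤ ·) ↔ ∃ j, e j = x := by simp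
  have hsort := Multiset.pairwise_sort (Finset.univ.val.map e) (· ≤ ·)
  generalize (Finset.univ.val.map e).sort (· ≤ ·) = l at hone hlarge hmem hsort
  cases l with
  | nil =>
    have : IsEmpty J := ⟨fun j => List.not_mem_nil ((hmem (e j)).mpr ⟨j, rfl⟩)⟩
    exact ⟨0, isEmptyElim⟩
  | cons x l =>
    obtain ⟨j₀, rfl⟩ := (hmem x).mp List.mem_cons_self
    simp only [List.tail_cons, Multiset.coe_count, Multiset.mem_coe] at hone hlarge
    obtain ⟨z₀, hz₀, hz₀_ne⟩ := exists_isBalanced_Ico (m := 0) (n := e j₀ + 1) (c := c) (K := K)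
      (by have := hce j₀; lia) {0}
    have hIic : Finset.Ico 0 (e j₀ + 1) = Finset.Iic (e j₀) := by ext; simp
    obtain ⟨z, -, hz⟩ := exists_isBalanced_of_pairwise_le l (e j₀) z₀ hsort (hIic ▸ hz₀) hone
      (fun _ k _ => by simpa using hz₀_ne k) hlarge
    exact ⟨z, fun j => hz _ ((hmem _).mpr ⟨j, rfl⟩)⟩

end BalancedExtension

section UpperBound

variable {n : ℕ}

theorem exists_ne_and_le_add_of_sum_le {ι : Type*} [Fintype ι] {u b : ι → ℕ} {c : ℕ}
    (hsum : ∑ i, u i ≤ c + ∑ i, b i) (hne : u ≠ b) : ∃ i, u i ≠ b i ∧ u i ≤ b i + c := by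
  classical
  by_contra! hlt
  obtain ⟨i₀, hi₀⟩ := Function.ne_iff.mp hne
  have hle : ∀ i, b i ≤ u i := fun i => by
    by_contra! h
    have := hlt i h.ne
    lia
  have hrest := Finset.sum_le_sum fun i (_ : i ∈ Finset.univ.erase i₀) => hle i
  have hi₀_lt := hlt i₀ hi₀
  rw [← Finset.add_sum_erase _ u (Finset.mem_univ i₀),
    ← Finset.add_sum_erase _ b (Finset.mem_univ i₀)] at hsum
  lia

theorem exists_monomial_cons_eq_sum_Iic {K : Type*} [Field K] [CharZero K] {c : ℕ} {b : Fin n → ℕ}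
    {z : Fin n → ℕ → K} (hz : ∀ i, IsBalanced c (Finset.Iic (b i)) (z i)) :
    ∃ w : (Fin n → ℕ) → K, monomial ((Finsupp.equivFunOnFinite.symm b).cons c) 1 =
      ∑ v ∈ Finset.Iic b, C (w v) * linearForm (Fin.cons 1 fun i => z i (v i)) ^
        ((Finsupp.equivFunOnFinite.symm b).cons c).degree := by
  choose w hw using fun i => (hz i).exists_weights
  set m := (Finsupp.equivFunOnFinite.symm b).cons c with hm
  have hmult : (m.multinomial : K) ≠ 0 := Nat.cast_ne_zero.mpr (Nat.multinomial_pos _ _).ne'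
  refine ⟨fun v => (m.multinomial : K)⁻¹ * ∏ i, w i (v i),
    (monomial_eq_sum_linearForm_pow_iff m _ _ _).mpr fun m' hm' => ?_⟩
  have hmoments : ∑ v ∈ Finset.Iic b, (∏ i, w i (v i)) *
      eval (Fin.cons 1 fun i => z i (v i) : Fin (n + 1) → K) (monomial m' 1) =
        ∏ i, ∑ k ∈ Finset.Iic (b i), w i k * z i k ^ m' i.succ := by
    rw [Finset.prod_univ_sum]
    refine Finset.sum_congr rfl fun v _ => ?_
    simp [eval_monomial, Finsupp.prod_fintype, Fin.prod_univ_succ, Finset.prod_mul_distrib]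
  simp only [mul_assoc, ← Finset.mul_sum]
  rw [mul_inv_cancel_left₀ hmult, hmoments, coeff_monomial]
  have hsum : m' 0 + ∑ i : Fin n, m' i.succ = c + ∑ i, b i := by
    simpa [hm, degree_finsuppCons, Finsupp.degree_eq_sum, Fin.sum_univ_succ] using hm'
  split_ifs with h
  · subst h
    refine Finset.prod_eq_one fun i _ => ?_
    have hmi : m i.succ = b i := by simp [hm]
    rw [hw i _ (by rw [Nat.card_Iic]; lia), if_pos (by rw [Nat.card_Iic, hmi])]
  · have hne : (fun i : Fin n => m' i.succ) ≠ b := by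
      rintro rfl
      have h0 : m' 0 = c := by simpa using hsum
      exact h (Finsupp.ext (Fin.cases (by simp [hm, h0]) fun i => by simp [hm]))
    obtain ⟨i, hi, hic⟩ := exists_ne_and_le_add_of_sum_le (hsum ▸ Nat.le_add_left _ _) hne
    refine Finset.prod_eq_zero (Finset.mem_univ i) ?_
    rw [hw i _ (by rw [Nat.card_Iic]; lia), if_neg (by simpa using hi)]

theorem hasSimultaneousDecomposition_card {σ J ι : Type*} {F : J → MvPolynomial σ ℂ} (s : Finset ι)
    {L : ι → MvPolynomial σ ℂ} (hL : ∀ k, (L k).IsHomogeneous 1)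
    (hF : ∀ j, ∃ t ⊆ s, ∃ w : ι → ℂ, F j = ∑ k ∈ t, C (w k) * L k ^ (F j).totalDegree) :
    HasSimultaneousDecomposition F s.card := by
  classical
  refine ⟨fun k => L (s.equivFin.symm k), fun k => hL _, fun j => ?_⟩
  obtain ⟨t, hts, w, hw⟩ := hF j
  refine ⟨fun k => if (s.equivFin.symm k : ι) ∈ t then w (s.equivFin.symm k) else 0, ?_⟩
  rw [Equiv.sum_comp s.equivFin.symm fun k : s =>
      C (if (k : ι) ∈ t then w k else 0) * L k ^ (F j).totalDegree,
    Finset.sum_coe_sort s fun k => C (if k ∈ t then w k else 0) * L k ^ (F j).totalDegree]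
  nth_rw 1 [hw, ← Finset.sum_subset hts fun k _ hk => by simp [hk]]
  exact Finset.sum_congr rfl fun k hk => by rw [if_pos hk]

theorem hasSimultaneousDecomposition_card_biUnion_Iic {J : Type*} [Fintype J] {c : ℕ}
    {a : J → Fin n → ℕ} (ha : ∀ j i, c ≤ a j i) (hfree : IsFree c a) :
    HasSimultaneousDecomposition (fun j => specialMonomial c (a j))
      (Finset.univ.biUnion fun j => Finset.Iic (a j)).card := by
  choose z hz using fun i => exists_forall_isBalanced_Iic (K := ℂ) (fun j => ha j i) (hfree.1 i)
    (hfree.2 i)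
  refine hasSimultaneousDecomposition_card _
    (fun v => isHomogeneous_linearForm (Fin.cons 1 fun i => z i (v i))) fun j => ?_
  obtain ⟨w, hw⟩ := exists_monomial_cons_eq_sum_Iic fun i => hz i j
  rw [totalDegree_specialMonomial, specialMonomial_eq_monomial_finsuppCons]
  exact ⟨_, Finset.subset_biUnion_of_mem (fun j => Finset.Iic (a j)) (Finset.mem_univ j), w, hw⟩

end UpperBound

section Rank

variable {n c : ℕ}

theorem isLeast_hasSimultaneousDecomposition {J : Type*} [Fintype J] (hc : c ≠ 0)
    {a : J → Fin n → ℕ} (ha : ∀ j i, c ≤ a j i) (hfree : IsFree c a) :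
    IsLeast {r | HasSimultaneousDecomposition (fun j => specialMonomial c (a j)) r}
      (Finset.univ.biUnion fun j => Finset.Iic (a j)).card :=
  ⟨hasSimultaneousDecomposition_card_biUnion_Iic ha hfree,
    fun _ h => card_biUnion_Iic_le_of_hasSimultaneousDecomposition hc h⟩

theorem isFree_unit (a : Fin n → ℕ) : IsFree c fun _ : Unit => a := by
  have hgaps : ∀ i, successiveGaps (fun _ : Unit => a i) = 0 := fun i => by simp [successiveGaps]
  exact ⟨fun i => by simp [hgaps], fun i => by simp [hgaps]⟩

theorem isLeast_hasSimultaneousDecomposition_unit (hc : c ≠ 0) {a : Fin n → ℕ}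
    (ha : ∀ i, c ≤ a i) :
    IsLeast {r | HasSimultaneousDecomposition (fun _ : Unit => specialMonomial c a) r}
      (Finset.Iic a).card := by
  simpa using isLeast_hasSimultaneousDecomposition hc (fun _ => ha) (isFree_unit a)

theorem card_biUnion_Iic {ι α : Type*} [Fintype ι] [DecidableEq α] [SemilatticeInf α]
    [LocallyFiniteOrderBot α] (a : ι → α) :
    ((Finset.univ.biUnion fun j => Finset.Iic (a j)).card : ℤ) =
      ∑ S : {S : Finset ι // S.Nonempty},
        (-1) ^ (S.1.card + 1) * ((Finset.Iic (S.1.inf' S.2 a)).card : ℤ) := by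
  rw [Finset.inclusion_exclusion_card_biUnion]
  refine Fintype.sum_equiv (Equiv.subtypeEquivRight (by simp)) _ _ fun S => ?_
  have hS : S.1.Nonempty := (Finset.mem_filter.mp S.2).2
  have hinf : S.1.inf' hS (fun j => Finset.Iic (a j)) = Finset.Iic (S.1.inf' hS a) := by
    ext
    simp only [Finset.mem_inf', Finset.mem_Iic, Finset.le_inf'_iff]
  rw [hinf]
  rfl

end Rank

theorem mainTheorem2 {n : ℕ} {J : Type*} [Fintype J] (c : ℕ) (hc : 1 ≤ c)
    (a : J → Fin n → ℕ) (ha : ∀ j i, c ≤ a j i) (hfree : IsFree c a) :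
    (∃ r, HasSimultaneousDecomposition (fun j => specialMonomial c (a j)) r) ∧
    (∀ (S : Finset J) (hS : S.Nonempty),
      ∃ r, HasSimultaneousDecomposition (fun _ : Unit => gcdSpecialMonomial c a S hS) r) ∧
    (simultaneousWaringRank (fun j => specialMonomial c (a j)) : ℤ) =
      ∑ S : {S : Finset J // S.Nonempty},
        (-1 : ℤ) ^ (S.1.card + 1) * (waringRank (gcdSpecialMonomial c a S.1 S.2) : ℤ) := by
  have hc0 : c ≠ 0 := Nat.one_le_iff_ne_zero.mp hc
  have hrank := isLeast_hasSimultaneousDecomposition hc0 ha hfree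
  have hgcd : ∀ (S : Finset J) (hS : S.Nonempty),
      IsLeast {r | HasSimultaneousDecomposition (fun _ : Unit => gcdSpecialMonomial c a S hS) r}
        (Finset.Iic (S.inf' hS a)).card := fun S hS => by
    have hexp : S.inf' hS a = fun i => S.inf' hS fun j => a j i :=
      funext fun i => Finset.inf'_apply hS a i
    rw [hexp]
    exact isLeast_hasSimultaneousDecomposition_unit hc0 fun i =>
      Finset.le_inf' _ _ fun j _ => ha j i
  refine ⟨⟨_, hrank.1⟩, fun S hS => ⟨_, (hgcd S hS).1⟩, ?_⟩
  calc (simultaneousWaringRank fun j => specialMonomial c (a j) : ℤ)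
    _ = (Finset.univ.biUnion fun j => Finset.Iic (a j)).card := congrArg _ hrank.csInf_eq
    _ = ∑ S : {S : Finset J // S.Nonempty},
          (-1) ^ (S.1.card + 1) * ((Finset.Iic (S.1.inf' S.2 a)).card : ℤ) := card_biUnion_Iic a
    _ = _ := Finset.sum_congr rfl fun S _ => congrArg _ (congrArg _ (hgcd S.1 S.2).csInf_eq.symm)
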